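/- Let $n\ge 2$, let $F_n$ be the free group of rank $n$, identified with $\pi_1(R_n,*)$, where the rose $R_n$ is the graph with one vertex $*$ and $n$ oriented edges corresponding to the free generators. A finite based cover $p\colon (X,x_1)\to (R_n,*)$ is a connected graph $X$ with finitely many vertices, a covering map of graphs $p\colon X\to R_n$ and a chosen base vertex $x_1$ of $X$; it is called fully characteristic if the subgroup $\pi_1(X,x_1)\le F_n$ satisfies $\psi(\pi_1(X,x_1))\subseteq \pi_1(X,x_1)$ for every $\psi\in\mathrm{End}(F_n)$. In this case every $\phi\in \mathrm{End}(F_n)$ acts on the first (cellular) homology $H_1(X,\mathbb{Z})$: represent $\phi$ by a based map $f\colon (R_n,*)\to(R_n,*)$ and take the map induced on $H_1(X,\mathbb{Z})$ by the unique lift $f'\colon (X,x_1)\to (X,x_1)$ with $p\circ f'=f\circ p$. Theorem. Let $\phi\in \mathrm{End}(F_n)$. If for every finite fully characteristic based cover $(X,x_1)\to (R_n,*)$ the map that $\phi$ induces on $H_1(X,\mathbb{Z})$ is surjective, then $\phi$ is surjective, and hence an automorphism of $F_n$. -/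

import Mathlib

open Quiver

/-- The rose `R_n`: the graph with one vertex `*` and `n` oriented edges (petals), indexed by
`Fin n`. Graphs are given by quivers: the arrows are the edges, each with a chosen orientation.
Its fundamental group is identified with `FreeGroup (Fin n)`, the `i`-th petal being the `i`-th
free generator. -/
abbrev Rose (n : ℕ) : Type := SingleObj (Fin n)

/-- Edge paths in a graph, which may traverse the edges in both directions. -/
inductive EdgePath {V : Type} [Quiver.{0} V] (u : V) : V → Type
  | nil : EdgePath u u
  /-- continue along an edge in its direction -/
  | forward {v w : V} (γ : EdgePath u v) (e : v ⟶ w) : EdgePath u w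
  /-- continue along an edge against its direction -/
  | backward {v w : V} (γ : EdgePath u v) (e : w ⟶ v) : EdgePath u w

namespace EdgePath

variable {V : Type} [Quiver.{0} V]

/-- Concatenation of edge paths. -/
def comp {u v : V} (γ : EdgePath u v) : ∀ {w : V}, EdgePath v w → EdgePath u w
  | _, nil => γ
  | _, forward δ e => forward (comp γ δ) e
  | _, backward δ e => backward (comp γ δ) e

/-- The edge path traversed in the opposite direction. -/
def reverse {u : V} : ∀ {v : V}, EdgePath u v → EdgePath v u
  | _, nil => nil
  | _, forward γ e => (backward nil e).comp (reverse γ)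
  | _, backward γ e => (forward nil e).comp (reverse γ)

end EdgePath

/-- A connected based cover `p : (X, x₁) → (R_n, *)`: a graph `X`, a graph morphism `p` which is
bijective on outgoing and on incoming edges at every vertex, and a preferred base vertex `x₁`.
Every vertex of `X` lies over `*`. -/
structure BasedCover (n : ℕ) where
  /-- the vertices of `X` -/
  Vertex : Type
  /-- the oriented edges of `X` -/
  [quiver : Quiver.{0} Vertex]
  /-- the covering projection -/
  proj : Vertex ⥤q Rose n
  isCovering : proj.IsCovering
  /-- the preferred base point in the fibre of `*` -/
  base : Vertex
  /-- every vertex is joined to the base vertex by an edge path -/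
  connected : ∀ v : Vertex, Nonempty (EdgePath base v)

attribute [instance] BasedCover.quiver

namespace BasedCover

variable {n : ℕ} (X : BasedCover n)

/-- A cover is finite if it has finitely many sheets, that is, if the fibre of `*` is finite. -/
def IsFinite : Prop := Finite X.Vertex

variable {X}

/-- The projection to `R_n` of an edge path of `X`, read from its start to its end as a word in
the free generators and their inverses. -/
def word {u : X.Vertex} : ∀ {v : X.Vertex}, EdgePath u v → List (Fin n × Bool)
  | _, .nil => []
  | _, .forward γ e => word γ ++ [((X.proj.map e : Fin n), true)]
  | _, .backward γ e => word γ ++ [((X.proj.map e : Fin n), false)]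

theorem word_comp {u v w : X.Vertex} (p : EdgePath u v) (q : EdgePath v w) :
    word (p.comp q) = word p ++ word q := by
  induction q with
  | nil => simp [word, EdgePath.comp]
  | forward q e ih => simp [word, EdgePath.comp, ih]
  | backward q e ih => simp [word, EdgePath.comp, ih]

theorem mk_word_forward {u v w : X.Vertex} (γ : EdgePath u v) (e : v ⟶ w) :
    FreeGroup.mk (word (.forward γ e)) =
      FreeGroup.mk (word γ) * FreeGroup.of (X.proj.map e : Fin n) := by
  rw [word, ← FreeGroup.mul_mk]; rfl

theorem mk_word_backward {u v w : X.Vertex} (γ : EdgePath u v) (e : w ⟶ v) :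
    FreeGroup.mk (word (.backward γ e)) =
      FreeGroup.mk (word γ) * (FreeGroup.of (X.proj.map e : Fin n))⁻¹ := by
  rw [word, ← FreeGroup.mul_mk]; rfl

theorem mk_word_reverse {u v : X.Vertex} (p : EdgePath u v) :
    FreeGroup.mk (word p.reverse) = (FreeGroup.mk (word p))⁻¹ := by
  induction p with
  | nil => simp [word, EdgePath.reverse]
  | forward p e ih =>
    rw [EdgePath.reverse, word_comp, ← FreeGroup.mul_mk, ih, mk_word_forward, mk_word_backward,
      mul_inv_rev, word, ← FreeGroup.one_eq_mk, one_mul]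
  | backward p e ih =>
    rw [EdgePath.reverse, word_comp, ← FreeGroup.mul_mk, ih, mk_word_forward, mk_word_backward,
      mul_inv_rev, word, ← FreeGroup.one_eq_mk, one_mul, inv_inv]

variable (X)

/-- The subgroup `π₁(X, x₁) ≤ F_n`: the classes of the projections of all closed edge paths of `X`
at the base vertex. -/
def pi1 : Subgroup (FreeGroup (Fin n)) where
  carrier := {g | ∃ γ : EdgePath X.base X.base, FreeGroup.mk (word γ) = g}
  one_mem' := ⟨.nil, rfl⟩
  mul_mem' := by
    rintro _ _ ⟨γ, rfl⟩ ⟨δ, rfl⟩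
    exact ⟨γ.comp δ, by rw [word_comp, FreeGroup.mul_mk]⟩
  inv_mem' := by
    rintro _ ⟨γ, rfl⟩
    exact ⟨γ.reverse, mk_word_reverse γ⟩

/-- The cover is fully characteristic if `π₁(X, x₁)` is invariant under all endomorphisms of
`F_n`. -/
def IsFullyCharacteristic : Prop :=
  ∀ ψ : Monoid.End (FreeGroup (Fin n)), ∀ g ∈ X.pi1, ψ g ∈ X.pi1

/-! ### Cellular homology of the graph -/

/-- The cellular `0`-chains of `X`. -/
abbrev C0 : Type := X.Vertex →₀ ℤ

/-- The cellular `1`-chains of `X`: the free abelian group on the set of all edges. -/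
abbrev C1 : Type := Total X.Vertex →₀ ℤ

/-- The cellular boundary map, sending an edge to its end minus its start. -/
noncomputable def boundary : X.C1 →ₗ[ℤ] X.C0 :=
  Finsupp.lift X.C0 ℤ (Total X.Vertex)
    fun e => Finsupp.single e.right 1 - Finsupp.single e.left 1

/-- `H₁(X, ℤ)`. As the graph `X` has no cells of dimension two, these are the `1`-cycles. -/
noncomputable abbrev H1 : Type := LinearMap.ker X.boundary

variable {X}

/-- The cellular `1`-chain of an edge path: the signed sum of the edges it traverses. -/
noncomputable def pathChain {u : X.Vertex} : ∀ {v : X.Vertex}, EdgePath u v → X.C1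
  | _, .nil => 0
  | _, .forward γ e => pathChain γ + Finsupp.single ⟨_, _, e⟩ 1
  | _, .backward γ e => pathChain γ - Finsupp.single ⟨_, _, e⟩ 1

theorem boundary_single (e : Total X.Vertex) :
    X.boundary (Finsupp.single e 1) = Finsupp.single e.right 1 - Finsupp.single e.left 1 := by
  simp [boundary]

theorem boundary_pathChain {u v : X.Vertex} (γ : EdgePath u v) :
    X.boundary (pathChain γ) = Finsupp.single v 1 - Finsupp.single u 1 := by
  induction γ with
  | nil => simp [pathChain]
  | forward γ e ih => simp only [pathChain, map_add, ih, boundary_single]; abel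
  | backward γ e ih => simp only [pathChain, map_sub, ih, boundary_single]; abel

/-! ### Lifts of endomorphisms and their action on homology -/

variable (X)

/-- An endomorphism `φ` of `F_n` is represented by the based map `f : (R_n, *) → (R_n, *)` which
runs along the reduced edge path `φ(xᵢ)` on the `i`-th petal. This is the structure of a
base-point-preserving lift `f' : (X, x₁) → (X, x₁)` of `f`, so that `p ∘ f' = f ∘ p`: a map on
vertices and, for each edge, the edge path along which `f'` runs on that edge. -/
structure BasedLift (φ : Monoid.End (FreeGroup (Fin n))) where
  /-- the map on vertices -/
  obj : X.Vertex → X.Vertex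
  obj_base : obj X.base = X.base
  /-- the image of an edge -/
  path : ∀ {u v : X.Vertex}, (u ⟶ v) → EdgePath (obj u) (obj v)
  word_path : ∀ {u v : X.Vertex} (e : u ⟶ v),
    word (path e) = (φ (FreeGroup.of (X.proj.map e : Fin n))).toWord

variable {X}

namespace BasedLift

variable {φ : Monoid.End (FreeGroup (Fin n))} (f : X.BasedLift φ)

/-- The map induced by a lift on cellular `1`-chains. -/
noncomputable def chainMap : X.C1 →ₗ[ℤ] X.C1 :=
  Finsupp.lift X.C1 ℤ (Total X.Vertex) fun e => pathChain (f.path e.hom)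

theorem boundary_chainMap (c : X.C1) :
    X.boundary (f.chainMap c) = Finsupp.lmapDomain ℤ ℤ f.obj (X.boundary c) := by
  have h : X.boundary ∘ₗ f.chainMap = Finsupp.lmapDomain ℤ ℤ f.obj ∘ₗ X.boundary := by
    ext1 e
    ext1
    simp only [LinearMap.comp_apply, Finsupp.lsingle_apply, boundary_single, map_sub]
    simp [chainMap, boundary_pathChain]
  exact LinearMap.congr_fun h c

/-- The map induced by a lift on `H₁(X, ℤ)`. -/
noncomputable def homologyMap : X.H1 →ₗ[ℤ] X.H1 :=
  f.chainMap.restrict fun c hc => by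
    rw [LinearMap.mem_ker] at hc ⊢
    rw [boundary_chainMap, hc, map_zero]

end BasedLift

/-! ### Existence and uniqueness of lifts -/

theorem exists_edge_from (u : X.Vertex) (i : Fin n) :
    ∃ v, ∃ e : u ⟶ v, (X.proj.map e : Fin n) = i := by
  obtain ⟨⟨v, e⟩, h⟩ := (X.isCovering.star_bijective u).2 ⟨SingleObj.star (Fin n), i⟩
  exact ⟨v, e, eq_of_heq (Sigma.mk.inj h).2⟩

theorem exists_edge_to (v : X.Vertex) (i : Fin n) :
    ∃ u, ∃ e : u ⟶ v, (X.proj.map e : Fin n) = i := by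
  obtain ⟨⟨u, e⟩, h⟩ := (X.isCovering.costar_bijective v).2 ⟨SingleObj.star (Fin n), i⟩
  exact ⟨u, e, eq_of_heq (Sigma.mk.inj h).2⟩

theorem edge_from_unique {u v v' : X.Vertex} (e : u ⟶ v) (e' : u ⟶ v')
    (h : (X.proj.map e : Fin n) = X.proj.map e') : (⟨v, e⟩ : Star u) = ⟨v', e'⟩ :=
  (X.isCovering.star_bijective u).1 (Sigma.ext (SingleObj.ext) (heq_of_eq h))

theorem edge_to_unique {u u' v : X.Vertex} (e : u ⟶ v) (e' : u' ⟶ v)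
    (h : (X.proj.map e : Fin n) = X.proj.map e') : (⟨u, e⟩ : Costar v) = ⟨u', e'⟩ :=
  (X.isCovering.costar_bijective v).1 (Sigma.ext (SingleObj.ext) (heq_of_eq h))

/-- Edge paths lift. -/
theorem exists_path (u : X.Vertex) (L : List (Fin n × Bool)) :
    ∃ v, ∃ γ : EdgePath u v, word γ = L := by
  induction L using List.reverseRecOn with
  | nil => exact ⟨u, .nil, rfl⟩
  | append_singleton L a ih =>
    obtain ⟨v, γ, rfl⟩ := ih
    obtain ⟨i, b⟩ := a
    cases b
    · obtain ⟨w, e, rfl⟩ := exists_edge_to v i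
      exact ⟨w, .backward γ e, rfl⟩
    · obtain ⟨w, e, rfl⟩ := exists_edge_from v i
      exact ⟨w, .forward γ e, rfl⟩

/-- Lifts of edge paths are unique. -/
theorem path_unique {u v v' : X.Vertex} (γ : EdgePath u v) (δ : EdgePath u v')
    (h : word γ = word δ) : (⟨v, γ⟩ : Σ w, EdgePath u w) = ⟨v', δ⟩ := by
  induction γ generalizing v' with
  | nil => cases δ <;> simp_all [word]
  | forward γ e ih =>
    cases δ with
    | nil => simp [word] at h
    | forward δ e' =>
      obtain ⟨h1, h2⟩ := List.append_inj' h rfl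
      cases ih δ h1
      cases edge_from_unique e e' (by simpa using h2)
      rfl
    | backward δ e' => simp [word] at h
  | backward γ e ih =>
    cases δ with
    | nil => simp [word] at h
    | forward δ e' => simp [word] at h
    | backward δ e' =>
      obtain ⟨h1, h2⟩ := List.append_inj' h rfl
      cases ih δ h1
      cases edge_to_unique e e' (by simpa using h2)
      rfl

/-- The permutation of the fibre given by the `i`-th generator. -/
noncomputable def monodromyGen (X : BasedCover n) (i : Fin n) : Equiv.Perm X.Vertex where
  toFun u := (exists_edge_from u i).choose
  invFun v := (exists_edge_to v i).choose
  left_inv u := by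
    obtain ⟨e, he⟩ := (exists_edge_from u i).choose_spec
    obtain ⟨e', he'⟩ := (exists_edge_to (exists_edge_from u i).choose i).choose_spec
    exact congrArg Sigma.fst (edge_to_unique e' e (he'.trans he.symm))
  right_inv v := by
    obtain ⟨e, he⟩ := (exists_edge_to v i).choose_spec
    obtain ⟨e', he'⟩ := (exists_edge_from (exists_edge_to v i).choose i).choose_spec
    exact congrArg Sigma.fst (edge_from_unique e' e (he'.trans he.symm))

theorem monodromyGen_edge {u v : X.Vertex} (e : u ⟶ v) :
    X.monodromyGen (X.proj.map e : Fin n) u = v := by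
  obtain ⟨e', he'⟩ := (exists_edge_from u (X.proj.map e : Fin n)).choose_spec
  exact congrArg Sigma.fst (edge_from_unique e' e he')

/-- The right action of `F_n` on the fibre, by lifting edge paths. -/
noncomputable def act (u : X.Vertex) (g : FreeGroup (Fin n)) : X.Vertex :=
  (FreeGroup.lift (fun i => MulOpposite.op (X.monodromyGen i)) g).unop u

theorem act_mul (u : X.Vertex) (g h : FreeGroup (Fin n)) : act u (g * h) = act (act u g) h := by
  simp [act]

theorem act_one (u : X.Vertex) : act u (1 : FreeGroup (Fin n)) = u := by
  simp [act]

theorem act_edge {u v : X.Vertex} (e : u ⟶ v) :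
    act u (FreeGroup.of (X.proj.map e : Fin n)) = v := by
  simp [act, monodromyGen_edge]

theorem act_edge_inv {u v : X.Vertex} (e : u ⟶ v) :
    act v (FreeGroup.of (X.proj.map e : Fin n))⁻¹ = u := by
  have h := congrArg (fun x => act x (FreeGroup.of (X.proj.map e : Fin n))⁻¹) (act_edge e)
  simpa only [← act_mul, mul_inv_cancel, act_one] using h.symm

theorem act_path {u v : X.Vertex} (γ : EdgePath u v) : act u (FreeGroup.mk (word γ)) = v := by
  induction γ with
  | nil => exact act_one u
  | forward γ e ih => rw [mk_word_forward, act_mul, ih, act_edge]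
  | backward γ e ih => rw [mk_word_backward, act_mul, ih, act_edge_inv]

/-- `π₁(X, x₁)` is the stabilizer of the base vertex. -/
theorem mem_pi1_iff (g : FreeGroup (Fin n)) : g ∈ X.pi1 ↔ act X.base g = X.base := by
  constructor
  · rintro ⟨γ, rfl⟩
    exact act_path γ
  · intro h
    obtain ⟨v, γ, hγ⟩ := exists_path X.base g.toWord
    have h1 : FreeGroup.mk (word γ) = g := by rw [hγ, FreeGroup.mk_toWord]
    have h2 : v = X.base := by rw [← act_path γ, h1, h]
    subst h2
    exact ⟨γ, h1⟩

/-- Lifting criterion: if `X` is fully characteristic, every endomorphism of `F_n` lifts. -/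
theorem IsFullyCharacteristic.nonempty_basedLift (hX : X.IsFullyCharacteristic)
    (φ : Monoid.End (FreeGroup (Fin n))) : Nonempty (X.BasedLift φ) := by
  let c : ∀ v, EdgePath X.base v := fun v => (X.connected v).some
  let o : X.Vertex → X.Vertex := fun v => act X.base (φ (FreeGroup.mk (word (c v))))
  have key : ∀ g h : FreeGroup (Fin n), act X.base g = act X.base h →
      act X.base (φ g) = act X.base (φ h) := by
    intro g h hgh
    have h1 : g * h⁻¹ ∈ X.pi1 := by
      rw [mem_pi1_iff, act_mul, hgh, ← act_mul, mul_inv_cancel, act_one]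
    have h2 := (mem_pi1_iff _).1 (hX φ _ h1)
    have h3 := congrArg (fun x => act x (φ h)) h2
    simpa only [← act_mul, map_mul, map_inv, inv_mul_cancel_right] using h3
  have step : ∀ {u v : X.Vertex} (e : u ⟶ v),
      ∃ γ : EdgePath (o u) (o v), word γ = (φ (FreeGroup.of (X.proj.map e : Fin n))).toWord := by
    intro u v e
    obtain ⟨w, γ, hγ⟩ := exists_path (o u) (φ (FreeGroup.of (X.proj.map e : Fin n))).toWord
    have hw : w = o v := by
      rw [← act_path γ, hγ, FreeGroup.mk_toWord, ← act_mul, ← map_mul]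
      apply key
      rw [act_mul, act_path, act_path, act_edge]
    subst hw
    exact ⟨γ, hγ⟩
  refine ⟨⟨o, ?_, fun e => (step e).choose, fun e => (step e).choose_spec⟩⟩
  have h := key (FreeGroup.mk (word (c X.base))) 1 (by rw [act_path, act_one])
  rwa [map_one, act_one] at h

namespace BasedLift

variable {φ : Monoid.End (FreeGroup (Fin n))}

theorem act_obj (f : X.BasedLift φ) {u v : X.Vertex} (γ : EdgePath u v) :
    act (f.obj u) (φ (FreeGroup.mk (word γ))) = f.obj v := by
  have hedge : ∀ {u v : X.Vertex} (e : u ⟶ v),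
      act (f.obj u) (φ (FreeGroup.of (X.proj.map e : Fin n))) = f.obj v := by
    intro u v e
    rw [← act_path (f.path e), f.word_path, FreeGroup.mk_toWord]
  induction γ with
  | nil => rw [word, ← FreeGroup.one_eq_mk, map_one, act_one]
  | forward γ e ih => rw [mk_word_forward, map_mul, act_mul, ih, hedge]
  | backward γ e ih =>
    rw [mk_word_backward, map_mul, act_mul, ih, map_inv, ← hedge e, ← act_mul, mul_inv_cancel,
        act_one]

/-- The action on homology does not depend on the lift. -/
theorem homologyMap_unique (f g : X.BasedLift φ) : f.homologyMap = g.homologyMap := by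
  have hobj : ∀ v, f.obj v = g.obj v := by
    intro v
    obtain ⟨γ⟩ := X.connected v
    have hf := f.act_obj (v := v) γ
    have hg := g.act_obj (v := v) γ
    rw [f.obj_base] at hf
    rw [g.obj_base] at hg
    rw [← hf, ← hg]
  have hchain : ∀ {a b a' b' : X.Vertex} (γ : EdgePath a b) (δ : EdgePath a' b'),
      a = a' → word γ = word δ → pathChain γ = pathChain δ := by
    intro a b a' b' γ δ ha h
    subst ha
    cases path_unique γ δ h
    rfl
  have h : f.chainMap = g.chainMap := by
    unfold chainMap
    congr 1
    funext e
    exact hchain _ _ (hobj _) (by rw [f.word_path, g.word_path])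
  ext c : 2
  exact LinearMap.congr_fun h c

end BasedLift

/-- The action of `φ ∈ End(F_n)` on `H₁(X, ℤ)` for a fully characteristic based cover `X`, that is,
the map induced by the base-point-preserving lift of `φ` to `X`. -/
noncomputable def homologyAction (X : BasedCover n) (hX : X.IsFullyCharacteristic)
    (φ : Monoid.End (FreeGroup (Fin n))) : X.H1 →ₗ[ℤ] X.H1 :=
  (hX.nonempty_basedLift φ).some.homologyMap

end BasedCover

/-! A surjective endomorphism of the finitely generated group `H₁(X, ℤ)` is injective. Suppose the
lift of `φ` sends vertices `u` and `v` to the same vertex. For a suitable power of a generator, the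
loops over it at `u` and at `v` have the same image chain, so injectivity makes them the same cycle.
Such loops run only forwards, so nothing cancels, and `u` lies on the loop at `v`
(`BasedLift.exists_act_power_of_obj_eq`). With two generators, `u` is reached from `v` by a power of
each; full characteristicity then forces `u = v` (`IsFullyCharacteristic.eq_of_act_power_eq`). Hence
the lift permutes the vertices (`BasedLift.obj_bijective`).

The vertices are the elements of `F_n ⧸ π₁(X)`, so `φ` is bijective on the finite quotients by the
fully invariant subgroups `permKernel` (`bijective_mod_permKernel`). Each action of `F_n` on a
finite set `S` factors through such a quotient. Marshall Hall's theorem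
(`exists_finite_perm_separating`) therefore gives surjectivity when applied to the range of `φ`, and
injectivity when applied to the trivial subgroup. -/

namespace BasedCover

variable {n : ℕ} {X : BasedCover n}

/-! ### Powers of a generator in a cover -/

theorem pathChain_eq_of_word_eq {a b a' b' : X.Vertex} (γ : EdgePath a b) (δ : EdgePath a' b')
    (ha : a = a') (h : word γ = word δ) : pathChain γ = pathChain δ := by
  subst ha
  cases path_unique γ δ h
  rfl

theorem mk_replicate_true (i : Fin n) (m : ℕ) :
    FreeGroup.mk (List.replicate m (i, true)) = FreeGroup.of i ^ m := by
  induction m with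
  | zero => rfl
  | succ m ih => rw [List.replicate_succ', ← FreeGroup.mul_mk, ih, pow_succ]; rfl

/-- All edges are traversed forwards, so no coefficients cancel and the support consists of edges
actually visited. -/
theorem pathChain_nonneg_and_right_of_ne_zero {u : X.Vertex} {i : Fin n} (m : ℕ)
    {v : X.Vertex} (γ : EdgePath u v) (h : word γ = List.replicate m (i, true))
    (t : Total X.Vertex) :
    0 ≤ pathChain γ t ∧ (pathChain γ t ≠ 0 → ∃ k : ℕ, act u (FreeGroup.of i ^ k) = t.right) := by
  classical
  induction m generalizing v with
  | zero =>
    cases γ with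
    | nil => simp [pathChain]
    | forward γ e => simp [word] at h
    | backward γ e => simp [word] at h
  | succ m ih =>
    have hend := act_path γ
    rw [h, mk_replicate_true] at hend
    rw [List.replicate_succ'] at h
    cases γ with
    | nil => simp [word] at h
    | forward γ e =>
      obtain ⟨h1, -⟩ := List.append_inj' h rfl
      obtain ⟨h3, h4⟩ := ih γ h1
      simp only [pathChain, Finsupp.add_apply, Finsupp.single_apply]
      split_ifs with ht
      · subst ht
        exact ⟨by omega, fun _ => ⟨_, hend⟩⟩
      · simpa using And.intro h3 h4
    | backward γ e => simp [word] at h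

/-- The exponent is the order of the monodromy permutation of the `i`-th petal, hence uniform in
`u`. Writing it as `m + 1` keeps the loop nonempty. -/
theorem exists_closed_path_power [Finite X.Vertex] (i : Fin n) :
    ∃ m : ℕ, ∀ u : X.Vertex, ∃ γ : EdgePath u u, word γ = List.replicate (m + 1) (i, true) := by
  obtain ⟨m, hm⟩ := Nat.exists_eq_succ_of_ne_zero (orderOf_pos (X.monodromyGen i)).ne'
  refine ⟨m, fun u => ?_⟩
  obtain ⟨v, γ, hγ⟩ := exists_path u (List.replicate (m + 1) (i, true))
  have hv := act_path γ
  rw [hγ, mk_replicate_true, act, map_pow, FreeGroup.lift_apply_of, ← MulOpposite.op_pow,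
    MulOpposite.unop_op, ← Nat.succ_eq_add_one, ← hm, pow_orderOf_eq_one] at hv
  cases hv
  exact ⟨γ, hγ⟩

/-! ### Lifts that are injective on homology -/

namespace BasedLift

variable {φ : Monoid.End (FreeGroup (Fin n))} (f : X.BasedLift φ)

theorem chainMap_single (e : Total X.Vertex) :
    f.chainMap (Finsupp.single e 1) = pathChain (f.path e.hom) := by
  simp [chainMap]

/-- Both images lift the same sequence of words from the same starting vertex, so unique path
lifting makes them agree edge by edge. -/
theorem chainMap_pathChain_power {i : Fin n} (m : ℕ) {u v u' v' : X.Vertex} (γ : EdgePath u v)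
    (δ : EdgePath u' v') (h : word γ = List.replicate m (i, true))
    (h' : word δ = List.replicate m (i, true)) (hu : f.obj u = f.obj u') :
    f.chainMap (pathChain γ) = f.chainMap (pathChain δ) := by
  induction m generalizing v v' with
  | zero =>
    cases γ <;> cases δ <;> simp_all [word, pathChain]
  | succ m ih =>
    rw [List.replicate_succ'] at h h'
    cases γ with
    | nil => simp [word] at h
    | backward γ e => simp [word] at h
    | forward γ e =>
      cases δ with
      | nil => simp [word] at h'
      | backward δ e' => simp [word] at h'
      | forward δ e' =>
        obtain ⟨h1, h2⟩ := List.append_inj' h rfl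
        obtain ⟨h1', h2'⟩ := List.append_inj' h' rfl
        have he : (X.proj.map e : Fin n) = X.proj.map e' := by
          simp only [List.cons.injEq, Prod.mk.injEq, and_true] at h2 h2'
          exact h2.trans h2'.symm
        simp only [pathChain, map_add, chainMap_single]
        rw [ih γ δ h1 h1']
        congr 1
        refine pathChain_eq_of_word_eq _ _ ?_ ?_
        · rw [← f.act_obj γ, ← f.act_obj δ, hu, h1, h1']
        · rw [f.word_path, f.word_path, he]

/-- If a lift is injective on homology, then two vertices with the same image lie on a common
cycle over each petal. -/
theorem exists_act_power_of_obj_eq [Finite X.Vertex] (hf : Function.Injective f.homologyMap)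
    {u v : X.Vertex} (huv : f.obj u = f.obj v) (i : Fin n) :
    ∃ k : ℕ, act v (FreeGroup.of i ^ k) = u := by
  obtain ⟨m, hm⟩ := exists_closed_path_power (X := X) i
  obtain ⟨γ, hγ⟩ := hm u
  obtain ⟨δ, hδ⟩ := hm v
  have hz : ∀ {w : X.Vertex} (p : EdgePath w w), pathChain p ∈ LinearMap.ker X.boundary := by
    intro w p
    rw [LinearMap.mem_ker, boundary_pathChain, sub_self]
  have hchain : pathChain γ = pathChain δ :=
    congrArg Subtype.val (@hf ⟨_, hz γ⟩ ⟨_, hz δ⟩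
      (Subtype.ext (f.chainMap_pathChain_power _ γ δ hγ hδ huv)))
  -- The last edge of the loop at `u` ends at `u`; its coefficient is at least `1`, since the rest
  -- of the loop contributes nonnegatively.
  have key : ∃ t : Total X.Vertex, t.right = u ∧ pathChain γ t ≠ 0 := by
    clear hchain
    generalize hw : u = w at γ hγ
    have hγ' := hγ
    rw [List.replicate_succ'] at hγ'
    cases γ with
    | nil => simp [word] at hγ'
    | backward γ e => simp [word] at hγ'
    | forward γ e =>
      obtain ⟨h1, -⟩ := List.append_inj' hγ' rfl
      have := (pathChain_nonneg_and_right_of_ne_zero _ γ h1 ⟨_, _, e⟩).1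
      refine ⟨⟨_, _, e⟩, rfl, ?_⟩
      simp only [pathChain, Finsupp.add_apply, Finsupp.single_eq_same]
      omega
  obtain ⟨t, rfl, ht⟩ := key
  rw [hchain] at ht
  exact (pathChain_nonneg_and_right_of_ne_zero _ δ hδ t).2 ht

end BasedLift

/-! ### Bijectivity of lifts on vertices -/

theorem act_mul_inv_cancel (u : X.Vertex) (g : FreeGroup (Fin n)) : act (act u g) g⁻¹ = u := by
  rw [← act_mul, mul_inv_cancel, act_one]

theorem exists_act_base (u : X.Vertex) : ∃ g, act X.base g = u := by
  obtain ⟨γ⟩ := X.connected u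
  exact ⟨_, act_path γ⟩

/-- Conjugations are endomorphisms, so `π₁` is normal and all vertices have the same stabilizer. -/
theorem IsFullyCharacteristic.act_eq_self_iff (hX : X.IsFullyCharacteristic) (u : X.Vertex)
    (g : FreeGroup (Fin n)) : act u g = u ↔ g ∈ X.pi1 := by
  obtain ⟨a, rfl⟩ := exists_act_base u
  have h1 : act (act X.base a) g = act X.base a ↔ a * g * a⁻¹ ∈ X.pi1 := by
    rw [mem_pi1_iff, act_mul, act_mul]
    constructor
    · intro h
      rw [h, act_mul_inv_cancel]
    · intro h
      have := congrArg (act · a) h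
      simpa only [← act_mul, inv_mul_cancel, mul_one, inv_mul_cancel_right] using this
  rw [h1]
  constructor
  · intro h
    have h2 : MulAut.conj a⁻¹ (a * g * a⁻¹) ∈ X.pi1 := hX (MulAut.conj a⁻¹).toMonoidHom _ h
    rw [MulAut.conj_apply] at h2
    simpa only [inv_inv, ← mul_assoc, inv_mul_cancel, one_mul, inv_mul_cancel_right] using h2
  · exact fun h => hX (MulAut.conj a).toMonoidHom _ h

/-- Distinct petals have independent images in the deck group of a fully characteristic cover. -/
theorem IsFullyCharacteristic.eq_of_act_power_eq (hX : X.IsFullyCharacteristic) {u v : X.Vertex}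
    {i j : Fin n} (hij : i ≠ j) {k l : ℕ} (hk : act v (FreeGroup.of i ^ k) = u)
    (hl : act v (FreeGroup.of j ^ l) = u) : u = v := by
  have h1 : act v (FreeGroup.of i ^ k * (FreeGroup.of j ^ l)⁻¹) = v := by
    rw [act_mul, hk, ← hl, act_mul_inv_cancel]
  rw [hX.act_eq_self_iff] at h1
  -- This endomorphism fixes the `i`-th generator and kills the `j`-th, so it leaves only the power
  -- of the `i`-th generator in `π₁`.
  let ψ : FreeGroup (Fin n) →* FreeGroup (Fin n) :=
    FreeGroup.lift fun a => if a = i then FreeGroup.of i else 1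
  have h2 : ψ (FreeGroup.of i ^ k * (FreeGroup.of j ^ l)⁻¹) ∈ X.pi1 := hX ψ _ h1
  simp only [ψ, map_mul, map_pow, map_inv, FreeGroup.lift_apply_of, if_true, hij.symm, if_false,
    one_pow, inv_one, mul_one] at h2
  rw [← hk]
  exact (hX.act_eq_self_iff v _).2 h2

theorem finite_total [Finite X.Vertex] : Finite (Total X.Vertex) := by
  refine Finite.of_injective
    (fun t : Total X.Vertex => (t.left, (X.proj.map t.hom : Fin n))) ?_
  rintro ⟨u, v, e⟩ ⟨u', v', e'⟩ h
  simp only [Prod.mk.injEq] at h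
  obtain ⟨rfl, h⟩ := h
  cases edge_from_unique e e' h
  rfl

/-- A lift of `φ` to a finite fully characteristic cover that is surjective on homology is bijective
on vertices. -/
theorem BasedLift.obj_bijective (hn : 2 ≤ n) [Finite X.Vertex] (hX : X.IsFullyCharacteristic)
    {φ : Monoid.End (FreeGroup (Fin n))} (f : X.BasedLift φ)
    (hf : Function.Surjective f.homologyMap) : Function.Bijective f.obj := by
  have := X.finite_total
  have hinj : Function.Injective f.homologyMap :=
    IsNoetherian.injective_of_surjective_endomorphism _ hf
  refine Function.Injective.bijective_of_finite fun u v huv => ?_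
  obtain ⟨k, hk⟩ := f.exists_act_power_of_obj_eq hinj huv ⟨0, by omega⟩
  obtain ⟨l, hl⟩ := f.exists_act_power_of_obj_eq hinj huv ⟨1, by omega⟩
  exact hX.eq_of_act_power_eq (by simp) hk hl

/-- Identifies the vertex map with the map that `φ` induces on cosets of `π₁`. -/
theorem BasedLift.obj_act_base {φ : Monoid.End (FreeGroup (Fin n))} (f : X.BasedLift φ)
    (g : FreeGroup (Fin n)) : f.obj (act X.base g) = act X.base (φ g) := by
  obtain ⟨v, γ, hγ⟩ := exists_path X.base g.toWord
  have hg : FreeGroup.mk (word γ) = g := by rw [hγ, FreeGroup.mk_toWord]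
  have h := f.act_obj γ
  rw [hg, f.obj_base] at h
  rw [h, ← hg, act_path]

/-! ### The cover of a normal subgroup -/

/-- The edges of the Cayley graph of `F_n ⧸ Γ`. -/
abbrev cayleyQuiver (Γ : Subgroup (FreeGroup (Fin n))) [Γ.Normal] :
    Quiver.{0} (FreeGroup (Fin n) ⧸ Γ) where
  Hom a b := {i : Fin n // a * (FreeGroup.of i : FreeGroup (Fin n)) = b}

/-- The projection of the Cayley graph of `F_n ⧸ Γ` to the rose. -/
abbrev cayleyProj (Γ : Subgroup (FreeGroup (Fin n))) [Γ.Normal] :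
    letI := cayleyQuiver Γ
    (FreeGroup (Fin n) ⧸ Γ) ⥤q Rose n :=
  letI := cayleyQuiver Γ
  { obj := fun _ => SingleObj.star (Fin n)
    map := fun e => e.1 }

theorem cayleyProj_isCovering (Γ : Subgroup (FreeGroup (Fin n))) [Γ.Normal] :
    letI := cayleyQuiver Γ
    (cayleyProj Γ).IsCovering := by
  let := cayleyQuiver Γ
  refine ⟨fun u => ⟨?_, ?_⟩, fun u => ⟨?_, ?_⟩⟩
  · rintro ⟨v, i, rfl⟩ ⟨v', i', rfl⟩ h
    obtain rfl : i = i' := eq_of_heq (Sigma.mk.inj h).2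
    rfl
  · rintro ⟨v, i⟩
    exact ⟨⟨_, i, rfl⟩, rfl⟩
  · rintro ⟨v, i, h1⟩ ⟨v', i', h2⟩ h
    obtain rfl : i = i' := eq_of_heq (Sigma.mk.inj h).2
    obtain rfl : v = v' := mul_right_cancel (h1.trans h2.symm)
    rfl
  · rintro ⟨v, i⟩
    exact ⟨⟨u * (FreeGroup.of i : FreeGroup (Fin n))⁻¹, i, inv_mul_cancel_right _ _⟩, rfl⟩

theorem exists_cayley_path (Γ : Subgroup (FreeGroup (Fin n))) [Γ.Normal]
    (g : FreeGroup (Fin n)) :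
    letI := cayleyQuiver Γ
    Nonempty (EdgePath (1 : FreeGroup (Fin n) ⧸ Γ) g) := by
  let := cayleyQuiver Γ
  have step : ∀ (a : FreeGroup (Fin n) ⧸ Γ) (g : FreeGroup (Fin n)),
      Nonempty (EdgePath a (a * (g : FreeGroup (Fin n) ⧸ Γ))) := by
    intro a g
    induction g using FreeGroup.induction_on generalizing a with
    | C1 => rw [QuotientGroup.mk_one, mul_one]; exact ⟨.nil⟩
    | of i => exact ⟨.forward .nil ⟨i, rfl⟩⟩
    | inv_of i _ =>
      exact ⟨.backward .nil ⟨i, by rw [QuotientGroup.mk_inv, inv_mul_cancel_right]⟩⟩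
    | mul x y hx hy =>
      obtain ⟨p⟩ := hx a
      obtain ⟨q⟩ := hy (a * x)
      rw [QuotientGroup.mk_mul, ← mul_assoc]
      exact ⟨p.comp q⟩
  simpa using step 1 g

/-- The based cover of the rose with fundamental group a given normal subgroup. -/
def ofNormal (Γ : Subgroup (FreeGroup (Fin n))) [Γ.Normal] : BasedCover n where
  Vertex := FreeGroup (Fin n) ⧸ Γ
  quiver := cayleyQuiver Γ
  proj := cayleyProj Γ
  isCovering := cayleyProj_isCovering Γ
  base := 1
  connected v := by
    induction v using QuotientGroup.induction_on with
    | H g => exact exists_cayley_path Γ g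

instance (Γ : Subgroup (FreeGroup (Fin n))) [Γ.Normal] : Group (ofNormal Γ).Vertex :=
  inferInstanceAs (Group (FreeGroup (Fin n) ⧸ Γ))

/-- The quotient map from `F_n` to the vertices of the Cayley graph of `F_n ⧸ Γ`. -/
def toVertex (Γ : Subgroup (FreeGroup (Fin n))) [Γ.Normal] :
    FreeGroup (Fin n) →* (ofNormal Γ).Vertex :=
  QuotientGroup.mk' Γ

theorem mul_toVertex_word (Γ : Subgroup (FreeGroup (Fin n))) [Γ.Normal]
    {u v : (ofNormal Γ).Vertex} (γ : EdgePath u v) :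
    u * toVertex Γ (FreeGroup.mk (word γ)) = v := by
  induction γ with
  | nil => exact mul_one _
  | forward γ e ih =>
    rw [mk_word_forward, map_mul, ← mul_assoc, ih]
    exact e.2
  | backward γ e ih =>
    rw [mk_word_backward, map_mul, ← mul_assoc, ih, map_inv]
    exact mul_inv_eq_of_eq_mul e.2.symm

theorem pi1_ofNormal (Γ : Subgroup (FreeGroup (Fin n))) [Γ.Normal] : (ofNormal Γ).pi1 = Γ := by
  ext g
  rw [mem_pi1_iff]
  obtain ⟨v, γ, hγ⟩ := exists_path (ofNormal Γ).base g.toWord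
  have h1 := act_path γ
  have h2 := mul_toVertex_word Γ γ
  rw [hγ, FreeGroup.mk_toWord] at h1 h2
  rw [h1, ← h2, mul_eq_left]
  exact QuotientGroup.eq_one_iff g

end BasedCover

/-! ### Finite quotients of free groups -/

/-- Finitely many partial permutations, given by restricting an action of a free group to a finite
subset, extend to an action on that subset. The new action agrees with the old one along each word
that stays in the subset. -/
theorem exists_finite_freeGroup_action_extending {α Y : Type*} [MulAction (FreeGroup α) Y]
    (S : Set Y) [Finite S] :
    ∃ ρ : FreeGroup α →* Equiv.Perm S, ∀ (y : S) (L : List (α × Bool)),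
      (∀ L', L' <:+ L → FreeGroup.mk L' • (y : Y) ∈ S) →
        (ρ (FreeGroup.mk L) y : Y) = FreeGroup.mk L • (y : Y) := by
  classical
  have hext : ∀ a : α, ∃ σ : Equiv.Perm S, ∀ x : S, ∀ h : FreeGroup.of a • (x : Y) ∈ S,
      σ x = ⟨FreeGroup.of a • (x : Y), h⟩ := by
    intro a
    -- The generator acts as a partial bijection of `S`; finiteness of `S` allows it to be extended
    -- to a permutation.
    let e : {x : S // FreeGroup.of a • (x : Y) ∈ S} ≃
        {x : S // (FreeGroup.of a)⁻¹ • (x : Y) ∈ S} :=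
      { toFun := fun x => ⟨⟨FreeGroup.of a • (x.1 : Y), x.2⟩, by simp⟩
        invFun := fun x => ⟨⟨(FreeGroup.of a)⁻¹ • (x.1 : Y), x.2⟩, by simp⟩
        left_inv := fun x => by simp
        right_inv := fun x => by simp }
    exact ⟨e.extendSubtype, fun x h => e.extendSubtype_apply_of_mem x h⟩
  choose σ hσ using hext
  refine ⟨FreeGroup.lift σ, fun y L => ?_⟩
  induction L with
  | nil =>
    intro _
    rw [← FreeGroup.one_eq_mk, map_one, one_smul, Equiv.Perm.one_apply]
  | cons p L ih =>
    intro hL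
    have ih' := ih fun L' h => hL L' (h.trans (List.suffix_cons _ _))
    have hmem := hL _ List.suffix_rfl
    obtain ⟨a, b⟩ := p
    have hb : FreeGroup.mk ((a, b) :: L) = FreeGroup.mk [(a, b)] * FreeGroup.mk L := by
      rw [FreeGroup.mul_mk]; rfl
    rw [hb, mul_smul] at hmem
    rw [hb, map_mul, mul_smul, Equiv.Perm.mul_apply, ← ih']
    rw [← ih'] at hmem
    cases b with
    | true =>
      change ((FreeGroup.lift σ (FreeGroup.of a)) _ : Y) = FreeGroup.of a • _
      rw [FreeGroup.lift_apply_of, hσ a _ hmem]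
    | false =>
      have hinv : (FreeGroup.mk [(a, false)] : FreeGroup α) = (FreeGroup.of a)⁻¹ := rfl
      rw [hinv] at hmem ⊢
      -- For an inverse letter, `σ a` is evaluated at the target point, which it sends back to the
      -- current one.
      have h := hσ a ⟨_, hmem⟩ (by simp)
      rw [map_inv, FreeGroup.lift_apply_of, Equiv.Perm.inv_eq_iff_eq.2
        (h.trans (Subtype.ext (smul_inv_smul _ _))).symm]

theorem closure_range_of_eq_range {α G : Type*} [Group G] (f : FreeGroup α →* G) :
    Subgroup.closure (Set.range fun i => f (FreeGroup.of i)) = f.range := by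
  rw [MonoidHom.range_eq_map, ← FreeGroup.closure_range_of, MonoidHom.map_closure,
    ← Set.range_comp]
  rfl

/-- Marshall Hall's theorem: finitely generated subgroups of a free group are separable. -/
theorem exists_finite_perm_separating {α : Type} {ι : Type*} [Finite ι]
    (a : ι → FreeGroup α) (H : Subgroup (FreeGroup α)) (hH : Subgroup.closure (Set.range a) = H)
    (g : FreeGroup α) (hg : g ∉ H) :
    ∃ (S : Type) (_ : Finite S) (ρ : FreeGroup α →* Equiv.Perm S) (s : S),
      (∀ h ∈ H, ρ h s = s) ∧ ρ g s ≠ s := by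
  classical
  -- The words to be traced: `g` at `none`, the generators of `H` elsewhere.
  let W : Option ι → FreeGroup α := fun o => o.elim g a
  -- A left action applies the last letter first, so the cosets met while tracing a word from `H`
  -- are those of its suffixes.
  let S : Set (FreeGroup α ⧸ H) :=
    ⋃ o, (fun L => ((FreeGroup.mk L : FreeGroup α) : FreeGroup α ⧸ H)) ''
      {L | L ∈ (W o).toWord.tails}
  have hS : S.Finite :=
    Set.finite_iUnion fun o => ((W o).toWord.tails.finite_toSet).image _
  have := hS.to_subtype
  have hmem : ∀ o L, L <:+ (W o).toWord → ((FreeGroup.mk L : FreeGroup α) : FreeGroup α ⧸ H) ∈ S :=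
    fun o L hL => Set.mem_iUnion.2 ⟨o, L, (List.mem_tails _ _).2 hL, rfl⟩
  obtain ⟨ρ, hρ⟩ := exists_finite_freeGroup_action_extending (α := α) S
  let s : S := ⟨((1 : FreeGroup α) : FreeGroup α ⧸ H), hmem none [] (List.nil_suffix)⟩
  have key : ∀ o, (ρ (W o) s : FreeGroup α ⧸ H) = (W o : FreeGroup α) := by
    intro o
    have h := hρ s (W o).toWord fun L' hL' => by
      simpa [s, ← QuotientGroup.mk_one, MulAction.Quotient.smul_coe] using hmem o L' hL'
    rw [FreeGroup.mk_toWord] at h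
    rw [h, MulAction.Quotient.smul_coe, smul_eq_mul, mul_one]
  refine ⟨S, inferInstance, ρ, s, ?_, fun h => hg ?_⟩
  -- Tracing a generator `a i` leads from `H` to `a i H = H`, so the stabilizer of `s` contains all
  -- of `H`; `g` leads to `gH ≠ H`.
  · have hle : H ≤ (MulAction.stabilizer (Equiv.Perm S) s).comap ρ := by
      refine hH.ge.trans ((Subgroup.closure_le _).2 ?_)
      rintro _ ⟨i, rfl⟩
      refine Subtype.ext ((key (some i)).trans ?_)
      refine (QuotientGroup.eq.2 ?_).symm
      rw [inv_one, one_mul]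
      exact hH.le (Subgroup.subset_closure ⟨i, rfl⟩)
    exact fun h hh => hle hh
  · have h1 := (key none).symm.trans (congrArg Subtype.val h)
    have h2 := QuotientGroup.eq.1 h1.symm
    rwa [inv_one, one_mul] at h2

/-! ### Fully invariant subgroups of finite index -/

/-- The intersection of the kernels of all actions of `G` on `S`. -/
def permKernel (G S : Type*) [Group G] : Subgroup G :=
  ⨅ ρ : G →* Equiv.Perm S, ρ.ker

theorem mem_permKernel {G S : Type*} [Group G] {g : G} :
    g ∈ permKernel G S ↔ ∀ ρ : G →* Equiv.Perm S, ρ g = 1 := by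
  simp [permKernel, Subgroup.mem_iInf, MonoidHom.mem_ker]

instance permKernel_normal (G S : Type*) [Group G] : (permKernel G S).Normal :=
  Subgroup.normal_iInf_normal fun _ => inferInstance

/-- Precomposing an action with `ψ` gives another action on the same set. -/
theorem permKernel_map_mem {G S : Type*} [Group G] (ψ : Monoid.End G) {g : G}
    (hg : g ∈ permKernel G S) : ψ g ∈ permKernel G S :=
  mem_permKernel.2 fun ρ => mem_permKernel.1 hg (ρ.comp ψ)

/-- An action is determined by the images of the finitely many generators, so this is a finite
intersection of finite-index kernels. -/
theorem finite_quotient_permKernel (α S : Type*) [Finite α] [Finite S] :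
    Finite (FreeGroup α ⧸ permKernel (FreeGroup α) S) := by
  have : Finite (FreeGroup α →* Equiv.Perm S) := Finite.of_equiv _ FreeGroup.lift
  have h : (permKernel (FreeGroup α) S).FiniteIndex :=
    Subgroup.finiteIndex_iInf fun ρ => inferInstance
  infer_instance

/-- If `φ` acts surjectively on the homology of each finite fully characteristic cover, then it
induces a bijection on each finite quotient `F_n ⧸ permKernel F_n S`. -/
theorem bijective_mod_permKernel {n : ℕ} (hn : 2 ≤ n) (φ : Monoid.End (FreeGroup (Fin n)))
    (hφ : ∀ (X : BasedCover n), X.IsFinite → ∀ hX : X.IsFullyCharacteristic,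
      Function.Surjective (X.homologyAction hX φ)) (S : Type) [Finite S] :
    (∀ g, φ g ∈ permKernel (FreeGroup (Fin n)) S → g ∈ permKernel (FreeGroup (Fin n)) S) ∧
      ∀ h, ∃ g, φ g * h⁻¹ ∈ permKernel (FreeGroup (Fin n)) S := by
  set Γ := permKernel (FreeGroup (Fin n)) S
  let X := BasedCover.ofNormal Γ
  have hpi : X.pi1 = Γ := BasedCover.pi1_ofNormal Γ
  have hfin : Finite X.Vertex := finite_quotient_permKernel (Fin n) S
  have hX : X.IsFullyCharacteristic := fun ψ g hg => by
    rw [hpi] at hg ⊢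
    exact permKernel_map_mem ψ hg
  let f : X.BasedLift φ := (hX.nonempty_basedLift φ).some
  have hf : Function.Bijective f.obj := f.obj_bijective hn hX (hφ X hfin hX)
  constructor
  · intro g hg
    rw [← hpi, BasedCover.mem_pi1_iff] at hg ⊢
    apply hf.1
    rw [f.obj_act_base, hg, f.obj_base]
  · intro h
    obtain ⟨u, hu⟩ := hf.2 (BasedCover.act X.base h)
    obtain ⟨g, rfl⟩ := BasedCover.exists_act_base u
    refine ⟨g, ?_⟩
    rw [← hpi, BasedCover.mem_pi1_iff, BasedCover.act_mul, ← f.obj_act_base, hu,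
      BasedCover.act_mul_inv_cancel]

/-! ### From finite quotients to the free group -/

theorem theorem1p2 (n : ℕ) (hn : 2 ≤ n) (φ : Monoid.End (FreeGroup (Fin n)))
    (hφ : ∀ (X : BasedCover n), X.IsFinite → ∀ hX : X.IsFullyCharacteristic,
      Function.Surjective (X.homologyAction hX φ)) :
    Function.Surjective φ ∧ ∃ α : FreeGroup (Fin n) ≃* FreeGroup (Fin n), ∀ g, α g = φ g := by
  have hsurj : Function.Surjective φ := by
    by_contra hns
    obtain ⟨g, hg⟩ := not_forall.1 hns
    obtain ⟨S, _, ρ, s, hfix, hmove⟩ :=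
      exists_finite_perm_separating _ _ (closure_range_of_eq_range φ) g fun h => hg (MonoidHom.mem_range.1 h)
    obtain ⟨a, ha⟩ := (bijective_mod_permKernel hn φ hφ S).2 g
    -- `φ a` and `g` act alike on `S`, yet `φ a` fixes `s` and `g` moves it.
    have h1 := mem_permKernel.1 ha ρ
    rw [map_mul, map_inv, mul_inv_eq_one] at h1
    exact hmove (h1 ▸ hfix _ ⟨a, rfl⟩)
  have hinj : Function.Injective φ := by
    refine (injective_iff_map_eq_one φ).2 fun g hg => ?_
    by_contra hne
    -- Residual finiteness of `F_n`: the trivial subgroup is generated by the empty family.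
    obtain ⟨S, _, ρ, s, -, hmove⟩ :=
      exists_finite_perm_separating (fun _ : Empty => (1 : FreeGroup (Fin n))) ⊥
        (by simp [Set.range_eq_empty]) g (by simpa using hne)
    have hmem := (bijective_mod_permKernel hn φ hφ S).1 g (by rw [hg]; exact one_mem _)
    exact hmove (by rw [mem_permKernel.1 hmem ρ, Equiv.Perm.one_apply])
  exact ⟨hsurj, MulEquiv.ofBijective φ ⟨hinj, hsurj⟩, fun _ => rfl⟩
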